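/- Let $\mathbb{D}$ be the open unit disc, $\mathbb{T}$ the unit circle and $m$ normalized arc length on $\mathbb{T}$; boundary values are radial limits $f(\zeta)=\lim_{r\to1^-}f(r\zeta)$. An inner function is a bounded analytic function $u$ on $\mathbb{D}$ with $|u(\zeta)|=1$ for $m$-a.e. $\zeta\in\mathbb{T}$ (unimodular constants are allowed). An outer function is a function on $\mathbb{D}$ of the form $$F(z)=e^{i\gamma}\exp\left(\int_{\mathbb{T}}\frac{\zeta+z}{\zeta-z}\,\phi(\zeta)\,dm(\zeta)\right)$$ with $\gamma\in\mathbb{R}$ and $\phi\in L^1(\mathbb{T},m)$ real-valued. The Smirnov class $N^+$ consists of the quotients $g/h$ of bounded analytic functions on $\mathbb{D}$ with $h$ outer. A real Smirnov function is an $f\in N^+$ whose boundary function is real-valued $m$-a.e. on $\mathbb{T}$. **Theorem (Helson).** If $f$ is a real Smirnov function, then there exist inner functions $\psi_1,\psi_2$ such that $\psi_1-\psi_2$ is outer and $$f=i\,\frac{\psi_1+\psi_2}{\psi_1-\psi_2}\quad\text{on }\mathbb{D}.$$ -/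

import Mathlib

open Filter Topology

namespace HardyDisc

/-- `f` is bounded and analytic on the open unit disc, i.e. its restriction to the disc lies in
`H^∞`. Functions on the disc are represented by functions `ℂ → ℂ`, only the values on
`Metric.ball 0 1` being relevant. -/
def IsBoundedAnalytic (f : ℂ → ℂ) : Prop :=
  AnalyticOnNhd ℂ f (Metric.ball 0 1) ∧ ∃ C : ℝ, ∀ z ∈ Metric.ball (0 : ℂ) 1, ‖f z‖ ≤ C

/-- The radial limit of `f` at the point `ζ` of the unit circle exists and equals `w`. -/
def HasRadialLimit (f : ℂ → ℂ) (ζ w : ℂ) : Prop :=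
  Tendsto (fun r : ℝ => f ((r : ℂ) * ζ)) (𝓝[<] (1 : ℝ)) (𝓝 w)

/-- Inner functions: bounded analytic functions on the disc whose boundary function is unimodular
almost everywhere. The points of the unit circle are written `circleMap 0 1 θ = exp (i θ)`; as this
is periodic in `θ`, "for almost every real `θ`" means "for almost every point of the circle". -/
def IsInner (u : ℂ → ℂ) : Prop :=
  IsBoundedAnalytic u ∧
    ∀ᵐ θ : ℝ, ∃ w : ℂ, ‖w‖ = 1 ∧ HasRadialLimit u (circleMap 0 1 θ) w

/-- Outer functions: `F z = e^{iγ} exp (∫ (ζ + z) / (ζ - z) φ(ζ) dm(ζ))` on the disc, where `γ` is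
real, `φ` is real-valued and integrable on the unit circle, and `m` is normalized arc length. -/
def IsOuter (F : ℂ → ℂ) : Prop :=
  ∃ (γ : ℝ) (φ : ℂ → ℝ), CircleIntegrable φ 0 1 ∧ ∀ z ∈ Metric.ball (0 : ℂ) 1,
    F z = Complex.exp (γ * Complex.I) *
      Complex.exp (Real.circleAverage (fun ζ : ℂ => (ζ + z) / (ζ - z) * (φ ζ : ℂ)) 0 1)

/-- The Smirnov class `N⁺`: quotients of bounded analytic functions on the disc with outer
denominator (which has no zeros in the disc). -/
def IsSmirnov (f : ℂ → ℂ) : Prop :=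
  ∃ g h : ℂ → ℂ, IsBoundedAnalytic g ∧ IsBoundedAnalytic h ∧ IsOuter h ∧
    ∀ z ∈ Metric.ball (0 : ℂ) 1, f z = g z / h z

/-- Real Smirnov functions: members of `N⁺` whose boundary function is real-valued almost everywhere
on the unit circle. -/
def IsRealSmirnov (f : ℂ → ℂ) : Prop :=
  IsSmirnov f ∧ ∀ᵐ θ : ℝ, ∃ x : ℝ, HasRadialLimit f (circleMap 0 1 θ) (x : ℂ)

end HardyDisc

/-!
Write `f = g / h` with `h` outer and let `x` be the real boundary function of `f`. On the circle
`|g + ih| = |g - ih| = |h| √(1 + x²)`, so dividing `g ± ih` by the outer function `E` with this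
boundary modulus gives inner functions `ψ₁` and `ψ₂`. Moreover `ψ₁ - ψ₂ = 2ih / E` is a quotient of
outer functions, hence outer, and `i (ψ₁ + ψ₂) / (ψ₁ - ψ₂) = g / h`. The logarithm of the modulus is
integrable because it lies above `log |h|` and `g + ih` is bounded.

That `ψ₁` and `ψ₂` are bounded is Smirnov's maximum principle: a bounded analytic function is
dominated by the outer function with the same boundary modulus. When that modulus is bounded below,
the quotient is bounded and is the Poisson integral of its boundary values; the general case follows
by truncating the logarithm of the modulus from below.

The boundary values come from Fatou's theorem. If `P_r` is the Poisson kernel in the angle,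
`-s P_r'(s) / 2π` is an approximate identity, so integrating by parts shows that the Poisson
integral of `φ` tends to `φ` wherever `φ` is the derivative of its indefinite integral. Bounded
analytic functions are derivatives of Lipschitz functions, and Lipschitz functions are
differentiable almost everywhere on the circle, so the same kernel yields their radial limits.
-/

namespace HardyDisc

open MeasureTheory Set Real

variable {E : Type*} [NormedAddCommGroup E]

lemma intervalIntegrable_comp_circleMap {φ : ℂ → E} (hφ : CircleIntegrable φ 0 1) (a b : ℝ) :
    IntervalIntegrable (fun θ => φ (circleMap 0 1 θ)) volume a b :=
  Function.Periodic.intervalIntegrable₀ (fun θ => by rw [periodic_circleMap 0 1 θ])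
    two_pi_pos.ne' hφ a b

variable [NormedSpace ℝ E]

/-- The Poisson kernel of the unit disc in polar coordinates: `r` is the modulus of the point of
the disc and `s` the angle between it and the point of the circle. -/
noncomputable def polarPoisson (r s : ℝ) : ℝ := (1 - r ^ 2) / (1 + r ^ 2 - 2 * r * cos s)

lemma polarPoisson_denom_pos {r : ℝ} (hr : r ∈ Ioo 0 1) (s : ℝ) :
    0 < 1 + r ^ 2 - 2 * r * cos s := by
  nlinarith [sq_pos_of_pos (sub_pos.2 hr.2), mul_nonneg hr.1.le (sub_nonneg.2 (cos_le_one s))]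

lemma polarPoisson_denom_pos_of_cos_ne_one {r s : ℝ} (hr : 0 < r) (hs : cos s ≠ 1) :
    0 < 1 + r ^ 2 - 2 * r * cos s := by
  nlinarith [sq_nonneg (1 - r), mul_pos hr (sub_pos.2 (lt_of_le_of_ne (cos_le_one s) hs))]

lemma polarPoisson_neg (r s : ℝ) : polarPoisson r (-s) = polarPoisson r s := by
  simp only [polarPoisson, cos_neg]

lemma contDiff_polarPoisson {r : ℝ} (hr : r ∈ Ioo 0 1) : ContDiff ℝ 1 (polarPoisson r) := by
  unfold polarPoisson
  exact ContDiff.div (by fun_prop) (by fun_prop) fun s => (polarPoisson_denom_pos hr s).ne'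

lemma continuous_deriv_polarPoisson {r : ℝ} (hr : r ∈ Ioo 0 1) :
    Continuous (deriv (polarPoisson r)) :=
  (contDiff_polarPoisson hr).continuous_deriv le_rfl

lemma hasDerivAt_polarPoisson {r : ℝ} (hr : r ∈ Ioo 0 1) (s : ℝ) :
    HasDerivAt (polarPoisson r) (deriv (polarPoisson r) s) s :=
  ((contDiff_polarPoisson hr).differentiable one_ne_zero s).hasDerivAt

lemma deriv_polarPoisson {r : ℝ} (hr : r ∈ Ioo 0 1) (s : ℝ) :
    deriv (polarPoisson r) s
      = -((1 - r ^ 2) * (2 * r * sin s) / (1 + r ^ 2 - 2 * r * cos s) ^ 2) := by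
  have hden := ((hasDerivAt_cos s).const_mul (2 * r)).const_sub (1 + r ^ 2)
  refine (((hasDerivAt_const s (1 - r ^ 2)).div hden
    (polarPoisson_denom_pos hr s).ne').congr_deriv ?_).deriv
  ring

lemma mul_deriv_polarPoisson_nonpos {r s : ℝ} (hr : r ∈ Ioo 0 1) (hs : s ∈ Icc (-π) π) :
    s * deriv (polarPoisson r) s ≤ 0 := by
  have hsin : 0 ≤ s * sin s := by
    rcases le_total 0 s with h | h
    · exact mul_nonneg h (sin_nonneg_of_nonneg_of_le_pi h hs.2)
    · exact mul_nonneg_of_nonpos_of_nonpos h (sin_nonpos_of_nonpos_of_neg_pi_le h hs.1)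
  have hr' : 0 ≤ 1 - r ^ 2 := by nlinarith [hr.1, hr.2]
  have hr0 := hr.1
  calc s * deriv (polarPoisson r) s
      = -((1 - r ^ 2) * (2 * r * (s * sin s)) / (1 + r ^ 2 - 2 * r * cos s) ^ 2) := by
        rw [deriv_polarPoisson hr]; ring
    _ ≤ 0 := neg_nonpos.2 (by positivity)

lemma tendstoUniformlyOn_mul_deriv_polarPoisson {k : Set ℝ} (hk : IsCompact k)
    (hcos : ∀ s ∈ k, cos s ≠ 1) :
    TendstoUniformlyOn (fun r s => s * deriv (polarPoisson r) s) 0 (𝓝[<] 1) k := by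
  let F : ℝ → ℝ → ℝ := fun r s =>
    s * -((1 - r ^ 2) * (2 * r * sin s) / (1 + r ^ 2 - 2 * r * cos s) ^ 2)
  have hF : ContinuousOn F.uncurry (Ioi 0 ×ˢ k) := by
    have hden : ∀ p ∈ Ioi (0 : ℝ) ×ˢ k, (1 + p.1 ^ 2 - 2 * p.1 * cos p.2) ^ 2 ≠ 0 := fun p hp =>
      pow_ne_zero 2 (polarPoisson_denom_pos_of_cos_ne_one hp.1 (hcos p.2 hp.2)).ne'
    simp only [F, Function.uncurry_def]
    fun_prop (disch := assumption)
  rw [Metric.tendstoUniformlyOn_iff]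
  intro ε hε
  obtain ⟨v, hv, hvF⟩ :=
    hk.mem_uniformity_of_prod hF (mem_Ioi.2 one_pos) (Metric.dist_mem_uniformity hε)
  rw [nhdsWithin_eq_nhds.2 (Ioi_mem_nhds one_pos)] at hv
  filter_upwards [mem_nhdsWithin_of_mem_nhds hv, Ioo_mem_nhdsLT one_pos] with r hrv hr s hs
  simpa [F, deriv_polarPoisson hr, dist_comm] using hvF r hrv s hs

lemma poissonKernel_circleMap (r θ s : ℝ) :
    poissonKernel 0 ((r : ℂ) * circleMap 0 1 θ) (circleMap 0 1 (s + θ)) = polarPoisson r s := by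
  have hrot : circleMap 0 1 (s + θ) - (r : ℂ) * circleMap 0 1 θ
      = (circleMap 0 1 s - r) * circleMap 0 1 θ := by
    simp only [circleMap, Complex.ofReal_one, Complex.ofReal_add, add_mul, Complex.exp_add,
      one_mul, zero_add]
    ring
  have hre : (circleMap 0 1 s - r).re = cos s - r := by simp [circleMap]
  have him : (circleMap 0 1 s - r).im = sin s := by simp [circleMap]
  have hdist : ‖circleMap 0 1 s - r‖ ^ 2 = 1 + r ^ 2 - 2 * r * cos s := by
    rw [← Complex.normSq_eq_norm_sq, Complex.normSq_apply, hre, him]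
    nlinarith [sin_sq_add_cos_sq s]
  simp [poissonKernel_def, hrot, hdist, polarPoisson]

/-- The Poisson integral over the unit circle of a vector-valued function. -/
noncomputable def poissonIntegral (φ : ℂ → E) (z : ℂ) : E :=
  circleAverage (poissonKernel 0 z • φ) 0 1

lemma poissonIntegral_mul_circleMap (φ : ℂ → E) (r θ : ℝ) :
    poissonIntegral φ (r * circleMap 0 1 θ)
      = (2 * π)⁻¹ • ∫ s in -π..π, polarPoisson r s • φ (circleMap 0 1 (s + θ)) := by
  have hper : Function.Periodic (fun s => polarPoisson r s • φ (circleMap 0 1 (s + θ)))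
      (2 * π) := fun s => by
    simp only [polarPoisson, cos_add_two_pi, add_right_comm s, periodic_circleMap 0 1 (s + θ)]
  rw [poissonIntegral, circleAverage_eq_integral_add θ]
  simp only [Pi.smul_apply', poissonKernel_circleMap]
  rw [← zero_add (2 * π), hper.intervalIntegral_add_eq 0 (-π), show -π + 2 * π = π by ring,
    zero_add]

lemma poissonIntegral_const {z : ℂ} (hz : z ∈ Metric.ball (0 : ℂ) 1) (c : ℝ) :
    poissonIntegral (fun _ => c) z = c :=
  InnerProductSpace.HarmonicOnNhd.circleAverage_poissonKernel_smul
    (fun _ _ => InnerProductSpace.harmonicAt_const c) hz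

lemma ofReal_mul_mem_ball {r : ℝ} (hr : r ∈ Ioo 0 1) {z : ℂ} (hz : ‖z‖ ≤ 1) :
    (r : ℂ) * z ∈ Metric.ball (0 : ℂ) 1 := by
  rw [mem_ball_zero_iff, norm_mul, Complex.norm_real, norm_of_nonneg hr.1.le]
  exact mul_lt_one_of_nonneg_of_lt_one_left hr.1.le hr.2 hz

lemma ofReal_mul_circleMap_mem_ball {r : ℝ} (hr : r ∈ Ioo 0 1) (θ : ℝ) :
    (r : ℂ) * circleMap 0 1 θ ∈ Metric.ball (0 : ℂ) 1 :=
  ofReal_mul_mem_ball hr (by simp)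

lemma integral_polarPoisson {r : ℝ} (hr : r ∈ Ioo 0 1) :
    ∫ s in -π..π, polarPoisson r s = 2 * π := by
  have h := poissonIntegral_const (ofReal_mul_circleMap_mem_ball hr 0) 1
  simp only [poissonIntegral_mul_circleMap, smul_eq_mul, mul_one] at h
  rwa [inv_mul_eq_one₀ (by positivity), eq_comm] at h

lemma integral_deriv_polarPoisson {r : ℝ} (hr : r ∈ Ioo 0 1) :
    ∫ s in -π..π, deriv (polarPoisson r) s = 0 := by
  rw [intervalIntegral.integral_deriv_eq_sub
    (fun s _ => (hasDerivAt_polarPoisson hr s).differentiableAt)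
    ((continuous_deriv_polarPoisson hr).intervalIntegrable _ _), polarPoisson_neg, sub_self]

lemma tendsto_polarPoisson_pi : Tendsto (fun r => polarPoisson r π) (𝓝[<] 1) (𝓝 0) := by
  have hden : (1 + 1 ^ 2 - 2 * 1 * cos π : ℝ) ≠ 0 := by norm_num
  have hcont : ContinuousAt (fun r => polarPoisson r π) 1 := by
    unfold polarPoisson
    fun_prop (disch := assumption)
  simpa [polarPoisson] using hcont.tendsto.mono_left nhdsWithin_le_nhds

lemma integral_mul_deriv_polarPoisson {r : ℝ} (hr : r ∈ Ioo 0 1) :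
    ∫ s in -π..π, s * deriv (polarPoisson r) s = 2 * π * polarPoisson r π - 2 * π := by
  rw [intervalIntegral.integral_mul_deriv_eq_deriv_mul
    (fun s _ => hasDerivAt_id' s) (fun s _ => hasDerivAt_polarPoisson hr s) (by simp)
    ((continuous_deriv_polarPoisson hr).intervalIntegrable _ _)]
  simp only [one_mul, integral_polarPoisson hr, polarPoisson_neg]
  ring

lemma tendsto_integral_mul_deriv_polarPoisson :
    Tendsto (fun r => ∫ s in -π..π, s * deriv (polarPoisson r) s) (𝓝[<] 1) (𝓝 (-(2 * π))) := by
  have hlim := (tendsto_polarPoisson_pi.const_mul (2 * π)).sub_const (2 * π)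
  rw [mul_zero, zero_sub] at hlim
  refine hlim.congr' ?_
  filter_upwards [Ioo_mem_nhdsLT one_pos] with r hr using (integral_mul_deriv_polarPoisson hr).symm

lemma tendsto_integral_mul_deriv_polarPoisson_smul [CompleteSpace E] {g : ℝ → E}
    (hg : ContinuousOn g (Icc (-π) π)) :
    Tendsto (fun r => ∫ s in -π..π, (s * deriv (polarPoisson r) s) • g s) (𝓝[<] 1)
      (𝓝 (-(2 * π) • g 0)) := by
  have hπ : -π ≤ π := by linarith [pi_pos]
  let φ : ℝ → ℝ → ℝ := fun r s => -(2 * π)⁻¹ * (s * deriv (polarPoisson r) s)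
  have hpeak : Tendsto (fun r => ∫ s in Icc (-π) π, φ r s • g s) (𝓝[<] 1) (𝓝 (g 0)) := by
    refine tendsto_setIntegral_peak_smul_of_integrableOn_of_tendsto measurableSet_Icc
      measurableSet_Icc subset_rfl self_mem_nhdsWithin measure_Icc_lt_top.ne ?nonneg ?unif ?mass
      ?meas hg.integrableOn_Icc (hg 0 (by simp [pi_nonneg]))
    case nonneg =>
      filter_upwards [Ioo_mem_nhdsLT one_pos] with r hr s hs
      exact mul_nonneg_of_nonpos_of_nonpos (neg_nonpos.2 (by positivity))
        (mul_deriv_polarPoisson_nonpos hr hs)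
    case unif =>
      intro u hu h0u
      have hcos : ∀ s ∈ Icc (-π) π \ u, cos s ≠ 1 := fun s hs h1 => by
        have hs0 := (cos_eq_one_iff_of_lt_of_lt (by linarith [hs.1.1, pi_pos])
          (by linarith [hs.1.2, pi_pos])).1 h1
        exact hs.2 (hs0 ▸ h0u)
      have hunif := (uniformContinuous_const_smul (-(2 * π)⁻¹)).comp_tendstoUniformlyOn
        (tendstoUniformlyOn_mul_deriv_polarPoisson (isCompact_Icc.diff hu) hcos)
      simpa [φ, Function.comp_def, Pi.zero_def] using hunif
    case mass =>
      have hlim := tendsto_integral_mul_deriv_polarPoisson.const_mul (-(2 * π)⁻¹)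
      rw [neg_mul_neg, inv_mul_cancel₀ two_pi_pos.ne'] at hlim
      refine hlim.congr fun r => ?_
      rw [integral_Icc_eq_integral_Ioc, ← intervalIntegral.integral_of_le hπ,
        intervalIntegral.integral_const_mul]
    case meas =>
      filter_upwards [Ioo_mem_nhdsLT one_pos] with r hr
      have := continuous_deriv_polarPoisson hr
      exact (by fun_prop : Continuous (φ r)).aestronglyMeasurable
  refine (hpeak.const_smul (-(2 * π))).congr fun r => ?_
  rw [integral_Icc_eq_integral_Ioc, ← intervalIntegral.integral_of_le hπ,
    ← intervalIntegral.integral_smul]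
  refine intervalIntegral.integral_congr fun s _ => ?_
  simp only [φ, smul_smul]
  congr 1
  field_simp

lemma tendsto_integral_deriv_polarPoisson_smul [CompleteSpace E] {K : ℝ → E} {K' : E}
    (hK : ContinuousOn K (Icc (-π) π)) (hK' : HasDerivAt K K' 0) :
    Tendsto (fun r => ∫ s in -π..π, deriv (polarPoisson r) s • K s) (𝓝[<] 1)
      (𝓝 (-(2 * π) • K')) := by
  have hπ : -π < π := by linarith [pi_pos]
  have hIcc : Icc (-π) π ∈ 𝓝 0 := Icc_mem_nhds (by simp [pi_pos]) pi_pos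
  have hslope : ContinuousOn (dslope K 0) (Icc (-π) π) :=
    (continuousOn_dslope hIcc).2 ⟨hK, hK'.differentiableAt⟩
  have hlim := tendsto_integral_mul_deriv_polarPoisson_smul hslope
  rw [dslope_same, hK'.deriv] at hlim
  refine hlim.congr' ?_
  filter_upwards [Ioo_mem_nhdsLT one_pos] with r hr
  have hcont := continuous_deriv_polarPoisson hr
  have hsub : ∀ s, (s * deriv (polarPoisson r) s) • dslope K 0 s
      = deriv (polarPoisson r) s • K s - deriv (polarPoisson r) s • K 0 := fun s => by
    rw [← smul_sub, ← sub_smul_dslope K 0 s, sub_zero, smul_smul, mul_comm]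
  have hint : IntervalIntegrable (fun s => deriv (polarPoisson r) s • K s) volume (-π) π :=
    (hcont.continuousOn.smul (uIcc_of_le hπ.le ▸ hK)).intervalIntegrable
  have hint0 : IntervalIntegrable (fun s => deriv (polarPoisson r) s • K 0) volume (-π) π :=
    Continuous.intervalIntegrable (by fun_prop) _ _
  simp only [hsub]
  rw [intervalIntegral.integral_sub hint hint0, intervalIntegral.integral_smul_const,
    integral_deriv_polarPoisson hr, zero_smul, sub_zero]

lemma tendsto_integral_polarPoisson_mul {k : ℝ → ℝ} {c : ℝ}
    (hk : IntervalIntegrable k volume (-π) π)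
    (hc : HasDerivAt (fun s => ∫ t in (0 : ℝ)..s, k t) c 0) :
    Tendsto (fun r => ∫ s in -π..π, polarPoisson r s * k s) (𝓝[<] 1) (𝓝 (2 * π * c)) := by
  have h0 : (0 : ℝ) ∈ uIcc (-π) π := by
    rw [uIcc_of_le (by linarith [pi_pos])]; simp [pi_nonneg]
  let K : ℝ → ℝ := fun s => ∫ t in (0 : ℝ)..s, k t
  have hKac : AbsolutelyContinuousOnInterval K (-π) π :=
    hk.absolutelyContinuousOnInterval_intervalIntegral h0
  have hK : ContinuousOn K (Icc (-π) π) := by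
    rw [← uIcc_of_le (by linarith [pi_pos])]; exact hKac.continuousOn
  have hderiv : ∀ᵐ s, s ∈ uIoc (-π) π → deriv K s = k s := by
    filter_upwards [hk.ae_hasDerivAt_integral] with s hs hs'
    exact (hs (uIoc_subset_uIcc hs') 0 h0).deriv
  have hparts : ∀ r ∈ Ioo (0 : ℝ) 1, ∫ s in -π..π, polarPoisson r s * k s
      = polarPoisson r π * (K π - K (-π)) - ∫ s in -π..π, deriv (polarPoisson r) s • K s := by
    intro r hr
    have hac : AbsolutelyContinuousOnInterval (polarPoisson r) (-π) π :=
      (contDiff_polarPoisson hr).contDiffOn.absolutelyContinuousOnInterval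
    calc ∫ s in -π..π, polarPoisson r s * k s = ∫ s in -π..π, polarPoisson r s * deriv K s :=
          intervalIntegral.integral_congr_ae (hderiv.mono fun s hs h => by rw [hs h])
      _ = _ := by
          rw [hac.integral_mul_deriv_eq_deriv_mul hKac, polarPoisson_neg]
          simp only [mul_sub, smul_eq_mul]
  have hlim := (tendsto_polarPoisson_pi.mul_const (K π - K (-π))).sub
    (tendsto_integral_deriv_polarPoisson_smul hK hc)
  simp only [zero_mul, zero_sub, smul_eq_mul, neg_mul, neg_neg] at hlim
  refine hlim.congr' ?_
  filter_upwards [Ioo_mem_nhdsLT one_pos] with r hr using (hparts r hr).symm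

theorem ae_tendsto_poissonIntegral {φ : ℂ → ℝ} (hφ : CircleIntegrable φ 0 1) :
    ∀ᵐ θ : ℝ, Tendsto (fun r : ℝ => poissonIntegral φ (r * circleMap 0 1 θ)) (𝓝[<] 1)
      (𝓝 (φ (circleMap 0 1 θ))) := by
  have hint := intervalIntegrable_comp_circleMap hφ
  have hloc : LocallyIntegrable (fun θ => φ (circleMap 0 1 θ)) :=
    fun θ => ⟨Ioc (θ - 1) (θ + 1), Ioc_mem_nhds (by linarith) (by linarith), (hint _ _).1⟩
  filter_upwards [LocallyIntegrable.ae_hasDerivAt_integral hloc] with θ hθ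
  have hderiv : HasDerivAt (fun s => ∫ t in (0 : ℝ)..s, φ (circleMap 0 1 (t + θ)))
      (φ (circleMap 0 1 θ)) 0 := by
    simp only [intervalIntegral.integral_comp_add_right fun t => φ (circleMap 0 1 t), zero_add]
    exact .comp_add_const 0 θ (by simpa only [zero_add] using hθ θ)
  have hlim := (tendsto_integral_polarPoisson_mul
    ((IntervalIntegrable.comp_add_right_iff enorm_ne_top).2 (hint _ _)) hderiv).const_smul (2 * π)⁻¹
  rw [smul_eq_mul, inv_mul_cancel_left₀ (by positivity)] at hlim
  exact hlim.congr fun r => (poissonIntegral_mul_circleMap φ r θ).symm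

lemma hasDerivAt_integral_comp_sub_smul {k : ℝ → ℝ} (hk : ContDiff ℝ 1 k) {C : ℝ}
    (hC : ∀ s, ‖deriv k s‖ ≤ C) {f : ℝ → E} {a b : ℝ} (hf : IntervalIntegrable f volume a b)
    (θ : ℝ) :
    HasDerivAt (fun θ => ∫ t in a..b, k (t - θ) • f t)
      (-∫ t in a..b, deriv k (t - θ) • f t) θ := by
  have hk' := hk.continuous_deriv le_rfl
  have hfm := hf.aestronglyMeasurable_restrict_uIoc
  rw [← intervalIntegral.integral_neg]
  refine (intervalIntegral.hasDerivAt_integral_of_dominated_loc_of_deriv_le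
    (F := fun θ t => k (t - θ) • f t) (F' := fun θ t => -(deriv k (t - θ) • f t))
    univ_mem (.of_forall fun θ => ?_) ?_ ?_ (.of_forall fun t _ θ _ => ?_)
    (hf.norm.const_mul C) (.of_forall fun t _ θ _ => ?_)).2
  · exact (hk.continuous.comp (by fun_prop)).aestronglyMeasurable.smul hfm
  · exact hf.continuousOn_smul (hk.continuous.comp (by fun_prop)).continuousOn
  · exact ((hk'.comp (by fun_prop)).aestronglyMeasurable.smul hfm).neg
  · rw [norm_neg, norm_smul]
    gcongr
    exact hC _
  · rw [← neg_smul]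
    have hderiv := (hk.differentiable one_ne_zero (t - θ)).hasDerivAt
    exact (hderiv.comp_const_sub t θ).smul_const (f t)

lemma hasDerivAt_poissonIntegral_mul_circleMap {φ : ℂ → E} (hφ : CircleIntegrable φ 0 1) {r : ℝ}
    (hr : r ∈ Ioo 0 1) (θ : ℝ) :
    HasDerivAt (fun θ : ℝ => poissonIntegral φ (r * circleMap 0 1 θ))
      (-(2 * π)⁻¹ • ∫ s in -π..π, deriv (polarPoisson r) s • φ (circleMap 0 1 (s + θ))) θ := by
  have hper : Function.Periodic (deriv (polarPoisson r)) (2 * π) := fun s => by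
    rw [← deriv_comp_add_const]
    simp only [polarPoisson, cos_add_two_pi]
    rfl
  obtain ⟨C, hC⟩ := (hper.isBounded_of_continuous two_pi_pos.ne'
    (continuous_deriv_polarPoisson hr)).exists_norm_le
  have hconv (θ : ℝ) : poissonIntegral φ (r * circleMap 0 1 θ)
      = (2 * π)⁻¹ • ∫ t in 0..2 * π, polarPoisson r (t - θ) • φ (circleMap 0 1 t) := by
    rw [poissonIntegral, circleAverage_def]
    congr 2 with t
    rw [Pi.smul_apply', ← poissonKernel_circleMap r θ, sub_add_cancel]
  have hshift : ∫ s in -π..π, deriv (polarPoisson r) s • φ (circleMap 0 1 (s + θ))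
      = ∫ t in 0..2 * π, deriv (polarPoisson r) (t - θ) • φ (circleMap 0 1 t) := by
    have hper' : Function.Periodic
        (fun t => deriv (polarPoisson r) (t - θ) • φ (circleMap 0 1 t)) (2 * π) := fun t => by
      simp only [add_sub_right_comm, hper _, periodic_circleMap 0 1 t]
    have htrans := intervalIntegral.integral_comp_add_right (a := -π) (b := π)
      (fun t => deriv (polarPoisson r) (t - θ) • φ (circleMap 0 1 t)) θ
    simp only [add_sub_cancel_right] at htrans
    rw [htrans, show π + θ = -π + θ + 2 * π by ring, hper'.intervalIntegral_add_eq _ 0, zero_add]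
  simp only [hconv]
  rw [hshift, neg_smul, ← smul_neg]
  exact (hasDerivAt_integral_comp_sub_smul (contDiff_polarPoisson hr)
    (fun s => hC _ (mem_range_self s)) hφ θ).const_smul _

lemma tendsto_deriv_mul_circleMap {F : ℂ → ℂ} (hF : DiffContOnCl ℂ F (Metric.ball 0 1)) {θ : ℝ}
    {F' : ℂ} (hF' : HasDerivAt (fun s => F (circleMap 0 1 s)) F' θ) :
    Tendsto (fun r : ℝ => r * circleMap 0 1 θ * Complex.I * deriv F (r * circleMap 0 1 θ))
      (𝓝[<] 1) (𝓝 F') := by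
  have hcont : Continuous fun s => F (circleMap 0 1 s) :=
    (closure_ball (0 : ℂ) one_ne_zero ▸ hF.continuousOn).comp_continuous
      (continuous_circleMap 0 1) fun s => by simp
  have hlim := (tendsto_integral_deriv_polarPoisson_smul (K := fun s => F (circleMap 0 1 (s + θ)))
    (hcont.comp (by fun_prop)).continuousOn
    (.comp_add_const 0 θ (by simpa only [zero_add] using hF'))).const_smul (-(2 * π)⁻¹)
  rw [smul_smul, neg_mul_neg, inv_mul_cancel₀ (by positivity), one_smul] at hlim
  refine hlim.congr' ?_
  filter_upwards [Ioo_mem_nhdsLT one_pos] with r hr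
  have hint : CircleIntegrable F 0 1 := hcont.intervalIntegrable _ _
  have hpoisson : (fun s : ℝ => F (r * circleMap 0 1 s))
      = fun s : ℝ => poissonIntegral F (r * circleMap 0 1 s) := funext fun s =>
    (hF.circleAverage_poissonKernel_smul (ofReal_mul_circleMap_mem_ball hr s)).symm
  have hchain : HasDerivAt (fun s : ℝ => F (r * circleMap 0 1 s))
      (deriv F (r * circleMap 0 1 θ) * (r * (circleMap 0 1 θ * Complex.I))) θ :=
    (hF.differentiableAt Metric.isOpen_ball
      (ofReal_mul_circleMap_mem_ball hr θ)).hasDerivAt.comp θ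
      ((hasDerivAt_circleMap 0 1 θ).const_mul (r : ℂ))
  rw [hpoisson] at hchain
  rw [(hasDerivAt_poissonIntegral_mul_circleMap hint hr θ).unique hchain]
  ring

lemma IsBoundedAnalytic.exists_lipschitz_primitive {H : ℂ → ℂ} (hH : IsBoundedAnalytic H) :
    ∃ (F : ℂ → ℂ) (L : NNReal), LipschitzWith L F ∧
      ∀ z ∈ Metric.ball (0 : ℂ) 1, HasDerivAt F (H z) z := by
  obtain ⟨han, C, hC⟩ := hH
  obtain ⟨F₀, hF₀⟩ := han.differentiableOn.isExactOn_ball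
  have hlip : LipschitzOnWith C.toNNReal F₀ (Metric.ball 0 1) :=
    (convex_ball 0 1).lipschitzOnWith_of_nnnorm_hasDerivWithin_le
      (fun z hz => (hF₀ z hz).hasDerivWithinAt)
      fun z hz => by simpa only [norm_toNNReal] using Real.toNNReal_mono (hC z hz)
  obtain ⟨F, hF, heq⟩ := hlip.extend_finite_dimension
  exact ⟨F, _, hF, fun z hz => (hF₀ z hz).congr_of_eventuallyEq
    (heq.symm.eventuallyEq_of_mem (Metric.isOpen_ball.mem_nhds hz))⟩

theorem IsBoundedAnalytic.ae_hasRadialLimit {H : ℂ → ℂ} (hH : IsBoundedAnalytic H) :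
    ∀ᵐ θ : ℝ, ∃ w, HasRadialLimit H (circleMap 0 1 θ) w := by
  obtain ⟨F, L, hF, hFH⟩ := hH.exists_lipschitz_primitive
  have hdiff : DiffContOnCl ℂ F (Metric.ball 0 1) :=
    ⟨fun z hz => (hFH z hz).differentiableAt.differentiableWithinAt, hF.continuous.continuousOn⟩
  filter_upwards [(hF.comp (lipschitzWith_circleMap 0 1)).ae_differentiableAt_real] with θ hθ
  have hden : Tendsto (fun r : ℝ => r * circleMap 0 1 θ * Complex.I) (𝓝[<] 1)
      (𝓝 (circleMap 0 1 θ * Complex.I)) := by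
    have hcont : Continuous fun r : ℝ => r * circleMap 0 1 θ * Complex.I := by fun_prop
    simpa using (hcont.tendsto 1).mono_left nhdsWithin_le_nhds
  have hne : circleMap 0 1 θ * Complex.I ≠ 0 := by simp [circleMap_eq_center_iff]
  refine ⟨_, ((tendsto_deriv_mul_circleMap hdiff hθ.hasDerivAt).div hden hne).congr' ?_⟩
  filter_upwards [Ioo_mem_nhdsLT one_pos] with r hr
  have hr0 : (r : ℂ) ≠ 0 := Complex.ofReal_ne_zero.2 hr.1.ne'
  rw [Pi.div_apply, (hFH _ (ofReal_mul_circleMap_mem_ball hr θ)).deriv]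
  have : circleMap 0 1 θ ≠ 0 := circleMap_ne_center one_ne_zero
  field_simp

/-- The boundary function of `f`, a junk value at the points where the radial limit of `f` does
not exist. -/
noncomputable def radialLimit (f : ℂ → ℂ) (ζ : ℂ) : ℂ :=
  limUnder (𝓝[<] (1 : ℝ)) fun r : ℝ => f (r * ζ)

lemma HasRadialLimit.radialLimit_eq {f : ℂ → ℂ} {ζ w : ℂ} (h : HasRadialLimit f ζ w) :
    radialLimit f ζ = w :=
  Tendsto.limUnder_eq h

lemma IsBoundedAnalytic.ae_hasRadialLimit_radialLimit {H : ℂ → ℂ} (hH : IsBoundedAnalytic H) :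
    ∀ᵐ θ : ℝ, HasRadialLimit H (circleMap 0 1 θ) (radialLimit H (circleMap 0 1 θ)) :=
  hH.ae_hasRadialLimit.mono fun _ ⟨_, hw⟩ => hw.radialLimit_eq ▸ hw

lemma tendsto_dilation {H : ℂ → ℂ} {z : ℂ} (hH : ContinuousAt H z) :
    Tendsto (fun r : ℝ => H (r * z)) (𝓝[<] 1) (𝓝 (H z)) := by
  have hdil : Tendsto (fun r : ℝ => (r : ℂ) * z) (𝓝[<] 1) (𝓝 z) := by
    have hcont : Continuous fun r : ℝ => (r : ℂ) * z := by fun_prop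
    simpa using (hcont.tendsto 1).mono_left nhdsWithin_le_nhds
  exact hH.tendsto.comp hdil

lemma diffContOnCl_dilation {H : ℂ → ℂ} (hH : DifferentiableOn ℂ H (Metric.ball 0 1)) {r : ℝ}
    (hr : r ∈ Ioo 0 1) : DiffContOnCl ℂ (fun w => H (r * w)) (Metric.ball 0 1) := by
  refine (hH.comp (differentiableOn_id.const_mul (r : ℂ)) fun w hw => ?_).diffContOnCl
  rw [closure_ball _ one_ne_zero, mem_closedBall_zero_iff] at hw
  exact ofReal_mul_mem_ball hr hw

lemma poissonIntegral_dilation {H : ℂ → ℂ} (hH : DifferentiableOn ℂ H (Metric.ball 0 1)) {r : ℝ}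
    (hr : r ∈ Ioo 0 1) {z : ℂ} (hz : z ∈ Metric.ball (0 : ℂ) 1) :
    poissonIntegral (fun ζ => H (r * ζ)) z = H (r * z) :=
  (diffContOnCl_dilation hH hr).circleAverage_poissonKernel_smul hz

lemma continuous_poissonKernel_circleMap {c z : ℂ} {R : ℝ} (hz : z ∈ Metric.ball c R) :
    Continuous fun θ => poissonKernel c z (circleMap c R θ) := by
  rw [poissonKernel_eq_re_herglotzRieszKernel]
  exact Complex.continuous_re.comp ((continuousOn_herglotzRieszKernel_sphere hz).comp_continuous
    (continuous_circleMap c R) (circleMap_mem_sphere' c R))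

lemma poissonKernel_nonneg {c z ζ : ℂ} {R : ℝ} (hz : z ∈ Metric.ball c R)
    (hζ : ζ ∈ Metric.sphere c R) : 0 ≤ poissonKernel c z ζ := by
  rw [mem_ball_iff_norm] at hz
  rw [mem_sphere_iff_norm] at hζ
  rw [poissonKernel_def, hζ]
  have : 0 ≤ R ^ 2 - ‖z - c‖ ^ 2 := sub_nonneg.2 (pow_le_pow_left₀ (norm_nonneg _) hz.le 2)
  positivity

lemma norm_poissonIntegral_le {v : ℂ → E} {B : ℝ} (hv : ∀ᵐ θ : ℝ, ‖v (circleMap 0 1 θ)‖ ≤ B)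
    {z : ℂ} (hz : z ∈ Metric.ball (0 : ℂ) 1) : ‖poissonIntegral v z‖ ≤ B := by
  rw [← poissonIntegral_const hz B, poissonIntegral, poissonIntegral, circleAverage_def,
    circleAverage_def, norm_smul, norm_of_nonneg (by positivity), smul_eq_mul]
  have hP := continuous_poissonKernel_circleMap hz
  gcongr
  refine intervalIntegral.norm_integral_le_of_norm_le (by positivity) (hv.mono fun θ hθ _ => ?_)
    ((hP.mul continuous_const).intervalIntegrable _ _)
  have hnonneg := poissonKernel_nonneg hz (circleMap_mem_sphere 0 zero_le_one θ)
  rw [Pi.smul_apply', norm_smul, norm_of_nonneg hnonneg, Pi.smul_apply', smul_eq_mul]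
  gcongr

lemma IsBoundedAnalytic.poissonIntegral_radialLimit {H : ℂ → ℂ} (hH : IsBoundedAnalytic H)
    {z : ℂ} (hz : z ∈ Metric.ball (0 : ℂ) 1) : poissonIntegral (radialLimit H) z = H z := by
  have ⟨han, C, hC⟩ := hH
  have hP := continuous_poissonKernel_circleMap hz
  have hHr : ∀ r ∈ Ioo (0 : ℝ) 1, Continuous fun θ => H (r * circleMap 0 1 θ) := fun r hr =>
    han.continuousOn.comp_continuous (by fun_prop) (ofReal_mul_circleMap_mem_ball hr)
  have hlim : Tendsto (fun r : ℝ => poissonIntegral (fun ζ => H (r * ζ)) z) (𝓝[<] 1)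
      (𝓝 (poissonIntegral (radialLimit H) z)) := by
    refine (intervalIntegral.tendsto_integral_filter_of_dominated_convergence
      (fun θ => ‖poissonKernel 0 z (circleMap 0 1 θ)‖ * C) ?_ ?_
      (Continuous.intervalIntegrable (by fun_prop) _ _) ?_).const_smul (2 * π)⁻¹
    · filter_upwards [Ioo_mem_nhdsLT one_pos] with r hr
      exact (hP.smul (hHr r hr)).aestronglyMeasurable
    · filter_upwards [Ioo_mem_nhdsLT one_pos] with r hr
      refine .of_forall fun θ _ => ?_
      rw [Pi.smul_apply', norm_smul]
      gcongr
      exact hC _ (ofReal_mul_circleMap_mem_ball hr θ)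
    · exact hH.ae_hasRadialLimit_radialLimit.mono fun θ hθ _ =>
        Tendsto.const_smul hθ (poissonKernel 0 z (circleMap 0 1 θ))
  refine tendsto_nhds_unique (hlim.congr' ?_) (tendsto_dilation (han z hz).continuousAt)
  filter_upwards [Ioo_mem_nhdsLT one_pos] with r hr
  exact poissonIntegral_dilation han.differentiableOn hr hz

lemma IsBoundedAnalytic.norm_le_of_ae_norm_radialLimit_le {H : ℂ → ℂ} (hH : IsBoundedAnalytic H)
    {B : ℝ} (hB : ∀ᵐ θ : ℝ, ‖radialLimit H (circleMap 0 1 θ)‖ ≤ B) {z : ℂ}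
    (hz : z ∈ Metric.ball (0 : ℂ) 1) : ‖H z‖ ≤ B :=
  hH.poissonIntegral_radialLimit hz ▸ norm_poissonIntegral_le hB hz

/-- The outer function that is positive at the origin and whose boundary modulus is `exp φ`. -/
noncomputable def outerOf (φ : ℂ → ℝ) (z : ℂ) : ℂ :=
  Complex.exp (circleAverage (fun ζ : ℂ => (ζ + z) / (ζ - z) * (φ ζ : ℂ)) 0 1)

lemma outerOf_ne_zero (φ : ℂ → ℝ) (z : ℂ) : outerOf φ z ≠ 0 := Complex.exp_ne_zero _

section

variable {φ ψ : ℂ → ℝ} (hφ : CircleIntegrable φ 0 1) (hψ : CircleIntegrable ψ 0 1)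

include hφ

lemma circleIntegrable_ofReal : CircleIntegrable (fun ζ => (φ ζ : ℂ)) 0 1 :=
  ⟨hφ.1.ofReal, hφ.2.ofReal⟩

lemma analyticOnNhd_outerOf : AnalyticOnNhd ℂ (outerOf φ) (Metric.ball 0 1) := by
  have han := analyticOnNhd_circleAverage_herglotzRieszKernel_smul (circleIntegrable_ofReal hφ)
  simp only [herglotzRieszKernel_def, sub_zero, smul_eq_mul] at han
  exact han.cexp

variable {z : ℂ} (hz : z ∈ Metric.ball (0 : ℂ) 1)

include hz

lemma norm_outerOf : ‖outerOf φ z‖ = exp (poissonIntegral φ z) := by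
  have hre := re_circleAverage_herglotzRieszKernel_smul hφ hz
  simp only [herglotzRieszKernel_def, sub_zero, smul_eq_mul] at hre
  rw [outerOf, Complex.norm_exp, hre, poissonIntegral, poissonKernel_eq_re_herglotzRieszKernel]
  rfl

lemma circleIntegrable_herglotz_mul :
    CircleIntegrable (fun ζ : ℂ => (ζ + z) / (ζ - z) * (φ ζ : ℂ)) 0 1 := by
  have hint := (circleIntegrable_ofReal hφ).continuousOn_smul
    (continuousOn_herglotzRieszKernel_sphere hz)
  simp only [herglotzRieszKernel_fun_def, sub_zero] at hint
  exact hint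

include hψ

lemma outerOf_add : outerOf (φ + ψ) z = outerOf φ z * outerOf ψ z := by
  rw [outerOf, outerOf, outerOf, ← Complex.exp_add, ← circleAverage_fun_add
    (circleIntegrable_herglotz_mul hφ hz) (circleIntegrable_herglotz_mul hψ hz)]
  simp only [Pi.add_apply, Complex.ofReal_add, mul_add]

lemma outerOf_sub : outerOf (φ - ψ) z = outerOf φ z / outerOf ψ z := by
  rw [eq_div_iff (outerOf_ne_zero ψ z), ← outerOf_add (hφ.sub hψ) hψ hz, sub_add_cancel]

end

lemma circleAverage_herglotz {z : ℂ} (hz : z ∈ Metric.ball (0 : ℂ) 1) :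
    circleAverage (fun ζ : ℂ => (ζ + z) / (ζ - z)) 0 1 = 1 := by
  have hne : ∀ ζ ∈ Metric.sphere (0 : ℂ) |1|, ζ - z ≠ 0 := fun ζ hζ =>
    sub_ne_zero.2 fun h => (Metric.sphere_disjoint_ball.le_bot ⟨hζ, by simpa [h] using hz⟩)
  have hcauchy : circleAverage (fun ζ : ℂ => ζ / (ζ - z)) 0 1 = 1 := by
    have := DiffContOnCl.circleAverage_smul_div (f := fun _ => (1 : ℂ)) (c := 0) (R := 1)
      (w := z) diffContOnCl_const (by simpa using hz)
    simpa only [sub_zero, smul_eq_mul, mul_one] using this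
  have hint : CircleIntegrable (fun ζ : ℂ => (2 : ℂ) • (ζ / (ζ - z))) 0 1 :=
    ContinuousOn.circleIntegrable' (by fun_prop (disch := assumption))
  calc circleAverage (fun ζ : ℂ => (ζ + z) / (ζ - z)) 0 1
      = circleAverage (fun ζ : ℂ => (2 : ℂ) • (ζ / (ζ - z)) - 1) 0 1 :=
        circleAverage_congr_sphere fun ζ hζ => by
          have := hne ζ hζ
          simp only [smul_eq_mul]
          field_simp
          ring
    _ = 1 := by
      rw [circleAverage_fun_sub hint (circleIntegrable_const 1 0 1), circleAverage_fun_smul,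
        hcauchy, circleAverage_const]
      norm_num

lemma outerOf_const {z : ℂ} (hz : z ∈ Metric.ball (0 : ℂ) 1) (c : ℝ) :
    outerOf (fun _ => c) z = exp c := by
  have hconst : circleAverage (fun ζ : ℂ => (ζ + z) / (ζ - z) * (c : ℂ)) 0 1 = c := by
    simp only [mul_comm _ (c : ℂ), ← smul_eq_mul (c : ℂ)]
    rw [circleAverage_fun_smul, circleAverage_herglotz hz, smul_eq_mul, mul_one]
  rw [outerOf, hconst, Complex.ofReal_exp]

lemma isOuter_iff {F : ℂ → ℂ} : IsOuter F ↔ ∃ c : ℂ, c ≠ 0 ∧ ∃ φ : ℂ → ℝ,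
    CircleIntegrable φ 0 1 ∧ ∀ z ∈ Metric.ball (0 : ℂ) 1, F z = c * outerOf φ z := by
  refine ⟨fun ⟨γ, φ, hφ, hF⟩ => ⟨_, Complex.exp_ne_zero _, φ, hφ, hF⟩,
    fun ⟨c, hc, φ, hφ, hF⟩ => ?_⟩
  have hlog := circleIntegrable_const (log ‖c‖) 0 1
  refine ⟨c.arg, _, hφ.add hlog, fun z hz => ?_⟩
  calc F z = Complex.exp (c.arg * Complex.I) * (outerOf φ z * ‖c‖) := by
        rw [hF z hz]
        nth_rw 1 [← Complex.norm_mul_exp_arg_mul_I c]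
        ring
    _ = Complex.exp (c.arg * Complex.I) * outerOf (φ + fun _ => log ‖c‖) z := by
        rw [outerOf_add hφ hlog hz, outerOf_const hz, exp_log (norm_pos_iff.2 hc)]

lemma isOuter_outerOf {φ : ℂ → ℝ} (hφ : CircleIntegrable φ 0 1) : IsOuter (outerOf φ) :=
  isOuter_iff.2 ⟨1, one_ne_zero, φ, hφ, fun _ _ => (one_mul _).symm⟩

lemma IsOuter.const_mul {F : ℂ → ℂ} (hF : IsOuter F) {c : ℂ} (hc : c ≠ 0) :
    IsOuter fun z => c * F z := by
  obtain ⟨d, hd, φ, hφ, hF⟩ := isOuter_iff.1 hF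
  exact isOuter_iff.2 ⟨c * d, mul_ne_zero hc hd, φ, hφ, fun z hz => by rw [hF z hz, mul_assoc]⟩

lemma IsOuter.div {F G : ℂ → ℂ} (hF : IsOuter F) (hG : IsOuter G) :
    IsOuter fun z => F z / G z := by
  obtain ⟨c, hc, φ, hφ, hF⟩ := isOuter_iff.1 hF
  obtain ⟨d, hd, ψ, hψ, hG⟩ := isOuter_iff.1 hG
  refine isOuter_iff.2 ⟨c / d, div_ne_zero hc hd, φ - ψ, hφ.sub hψ, fun z hz => ?_⟩
  rw [hF z hz, hG z hz, outerOf_sub hφ hψ hz, mul_div_mul_comm]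

lemma IsOuter.ne_zero {F : ℂ → ℂ} (hF : IsOuter F) {z : ℂ} (hz : z ∈ Metric.ball (0 : ℂ) 1) :
    F z ≠ 0 := by
  obtain ⟨c, hc, φ, -, hF⟩ := isOuter_iff.1 hF
  exact hF z hz ▸ mul_ne_zero hc (outerOf_ne_zero φ z)

/-- The radial limits of `|G|` on the unit circle are almost everywhere equal to `exp φ`. -/
def HasBoundaryLogModulus (G : ℂ → ℂ) (φ : ℂ → ℝ) : Prop :=
  ∀ᵐ θ : ℝ, Tendsto (fun r : ℝ => ‖G (r * circleMap 0 1 θ)‖) (𝓝[<] 1)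
    (𝓝 (exp (φ (circleMap 0 1 θ))))

lemma hasBoundaryLogModulus_outerOf {φ : ℂ → ℝ} (hφ : CircleIntegrable φ 0 1) :
    HasBoundaryLogModulus (outerOf φ) φ := by
  filter_upwards [ae_tendsto_poissonIntegral hφ] with θ hθ
  refine ((continuous_exp.tendsto _).comp hθ).congr' ?_
  filter_upwards [Ioo_mem_nhdsLT one_pos] with r hr
  exact (norm_outerOf hφ (ofReal_mul_circleMap_mem_ball hr θ)).symm

lemma IsOuter.exists_hasBoundaryLogModulus {F : ℂ → ℂ} (hF : IsOuter F) :
    ∃ φ : ℂ → ℝ, CircleIntegrable φ 0 1 ∧ HasBoundaryLogModulus F φ := by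
  obtain ⟨γ, φ, hφ, hF⟩ := hF
  refine ⟨φ, hφ, (hasBoundaryLogModulus_outerOf hφ).mono fun θ hθ => hθ.congr' ?_⟩
  filter_upwards [Ioo_mem_nhdsLT one_pos] with r hr
  rw [hF _ (ofReal_mul_circleMap_mem_ball hr θ), norm_mul, Complex.norm_exp_ofReal_mul_I, one_mul]
  rfl

lemma HasBoundaryLogModulus.div {F G : ℂ → ℂ} {φ ψ : ℂ → ℝ} (hF : HasBoundaryLogModulus F φ)
    (hG : HasBoundaryLogModulus G ψ) : HasBoundaryLogModulus (fun z => F z / G z) (φ - ψ) := by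
  filter_upwards [hF, hG] with θ hFθ hGθ
  simp only [norm_div, Pi.sub_apply, exp_sub]
  exact hFθ.div hGθ (exp_ne_zero _)

lemma HasBoundaryLogModulus.ae_norm_radialLimit_eq {G : ℂ → ℂ} {φ : ℂ → ℝ}
    (hG : HasBoundaryLogModulus G φ) (hGb : IsBoundedAnalytic G) :
    ∀ᵐ θ : ℝ, ‖radialLimit G (circleMap 0 1 θ)‖ = exp (φ (circleMap 0 1 θ)) := by
  filter_upwards [hG, hGb.ae_hasRadialLimit_radialLimit] with θ hmod hlim
  exact tendsto_nhds_unique hlim.norm hmod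

lemma IsBoundedAnalytic.div_outerOf {G : ℂ → ℂ} (hG : IsBoundedAnalytic G) {φ : ℂ → ℝ}
    (hφ : CircleIntegrable φ 0 1) {C : ℝ}
    (hC : ∀ z ∈ Metric.ball (0 : ℂ) 1, ‖G z‖ ≤ C * ‖outerOf φ z‖) :
    IsBoundedAnalytic fun z => G z / outerOf φ z :=
  ⟨hG.1.div (analyticOnNhd_outerOf hφ) fun z _ => outerOf_ne_zero φ z, C, fun z hz => by
    rw [norm_div, div_le_iff₀ (norm_pos_iff.2 (outerOf_ne_zero φ z))]
    exact hC z hz⟩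

section

variable {φ : ℂ → ℝ} (hφ : CircleIntegrable φ 0 1)

include hφ

lemma circleIntegrable_max_const (c : ℝ) : CircleIntegrable (fun ζ => max (φ ζ) c) 0 1 :=
  ⟨hφ.1.sup (circleIntegrable_const c 0 1).1, hφ.2.sup (circleIntegrable_const c 0 1).2⟩

variable {z : ℂ} (hz : z ∈ Metric.ball (0 : ℂ) 1)

include hz

lemma circleIntegrable_poissonKernel_smul : CircleIntegrable (poissonKernel 0 z • φ) 0 1 :=
  IntervalIntegrable.continuousOn_smul hφ (continuous_poissonKernel_circleMap hz).continuousOn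

lemma le_poissonIntegral {c : ℝ} (hc : ∀ ζ, c ≤ φ ζ) : c ≤ poissonIntegral φ z := by
  rw [← poissonIntegral_const hz c]
  refine circleAverage_mono (circleIntegrable_poissonKernel_smul (circleIntegrable_const c 0 1) hz)
    (circleIntegrable_poissonKernel_smul hφ hz) fun ζ hζ => ?_
  exact mul_le_mul_of_nonneg_left (hc ζ) (poissonKernel_nonneg hz (by simpa using hζ))

lemma tendsto_poissonIntegral_max_neg :
    Tendsto (fun n : ℕ => poissonIntegral (fun ζ => max (φ ζ) (-n)) z) atTop
      (𝓝 (poissonIntegral φ z)) := by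
  have hint {ψ : ℂ → ℝ} (hψ : CircleIntegrable ψ 0 1) := circleIntegrable_poissonKernel_smul hψ hz
  refine (intervalIntegral.tendsto_integral_filter_of_dominated_convergence
    (fun θ => ‖(poissonKernel 0 z • φ) (circleMap 0 1 θ)‖)
    (.of_forall fun n =>
      (hint (circleIntegrable_max_const hφ _)).aestronglyMeasurable_restrict_uIoc)
    (.of_forall fun n => .of_forall fun θ _ => ?_) (hint hφ).norm
    (.of_forall fun θ _ => tendsto_const_nhds.congr' ?_)).const_smul _
  · rw [Pi.smul_apply', Pi.smul_apply', norm_smul, norm_smul]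
    gcongr
    exact abs_le.2 ⟨(neg_abs_le _).trans (le_max_left _ _),
      max_le (le_abs_self _) ((neg_nonpos.2 n.cast_nonneg).trans (abs_nonneg _))⟩
  · filter_upwards [eventually_ge_atTop ⌈-φ (circleMap 0 1 θ)⌉₊] with n hn
    rw [Pi.smul_apply', Pi.smul_apply', max_eq_left (neg_le.1 (Nat.ceil_le.1 hn))]

end

lemma IsBoundedAnalytic.norm_le_norm_outerOf_of_le {G : ℂ → ℂ} (hG : IsBoundedAnalytic G)
    {φ ψ : ℂ → ℝ} (hGφ : HasBoundaryLogModulus G φ) (hψ : CircleIntegrable ψ 0 1)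
    (hφψ : ∀ ζ, φ ζ ≤ ψ ζ) {c : ℝ} (hc : ∀ ζ, c ≤ ψ ζ) {z : ℂ} (hz : z ∈ Metric.ball (0 : ℂ) 1) :
    ‖G z‖ ≤ ‖outerOf ψ z‖ := by
  obtain ⟨C, hC⟩ := hG.2
  have hdiv : IsBoundedAnalytic fun w => G w / outerOf ψ w := by
    refine hG.div_outerOf hψ (C := C * exp (-c)) fun w hw => (hC w hw).trans ?_
    rw [norm_outerOf hψ hw, mul_assoc, ← exp_add]
    refine le_mul_of_one_le_right ((norm_nonneg _).trans (hC w hw)) (one_le_exp ?_)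
    linarith [le_poissonIntegral hψ hw hc]
  have hquot : ‖G z / outerOf ψ z‖ ≤ 1 := by
    refine hdiv.norm_le_of_ae_norm_radialLimit_le ?_ hz
    filter_upwards [(hGφ.div (hasBoundaryLogModulus_outerOf hψ)).ae_norm_radialLimit_eq hdiv]
      with θ hθ
    rw [hθ, exp_le_one_iff, Pi.sub_apply, sub_nonpos]
    exact hφψ _
  rwa [norm_div, div_le_one (norm_pos_iff.2 (outerOf_ne_zero ψ z))] at hquot

theorem IsBoundedAnalytic.norm_le_norm_outerOf {G : ℂ → ℂ} (hG : IsBoundedAnalytic G)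
    {φ : ℂ → ℝ} (hφ : CircleIntegrable φ 0 1) (hGφ : HasBoundaryLogModulus G φ) {z : ℂ}
    (hz : z ∈ Metric.ball (0 : ℂ) 1) : ‖G z‖ ≤ ‖outerOf φ z‖ := by
  rw [norm_outerOf hφ hz]
  refine ge_of_tendsto' ((continuous_exp.tendsto _).comp (tendsto_poissonIntegral_max_neg hφ hz))
    fun n => ?_
  have htrunc := circleIntegrable_max_const hφ (-n)
  rw [Function.comp_apply, ← norm_outerOf htrunc hz]
  exact hG.norm_le_norm_outerOf_of_le hGφ htrunc (fun ζ => le_max_left _ _)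
    (fun ζ => le_max_right _ _) hz

theorem IsBoundedAnalytic.isInner_div_outerOf {G : ℂ → ℂ} (hG : IsBoundedAnalytic G)
    {φ : ℂ → ℝ} (hφ : CircleIntegrable φ 0 1) (hGφ : HasBoundaryLogModulus G φ) :
    IsInner fun z => G z / outerOf φ z := by
  have hdiv : IsBoundedAnalytic fun z => G z / outerOf φ z :=
    hG.div_outerOf hφ (C := 1) fun z hz => by
      rw [one_mul]; exact hG.norm_le_norm_outerOf hφ hGφ hz
  refine ⟨hdiv, ?_⟩
  filter_upwards [hdiv.ae_hasRadialLimit_radialLimit,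
    (hGφ.div (hasBoundaryLogModulus_outerOf hφ)).ae_norm_radialLimit_eq hdiv] with θ hlim hnorm
  exact ⟨_, by rw [hnorm, sub_self, Pi.zero_apply, exp_zero], hlim⟩

lemma HasBoundaryLogModulus.aestronglyMeasurable {G : ℂ → ℂ} {φ : ℂ → ℝ}
    (hG : ContinuousOn G (Metric.ball 0 1)) (hGφ : HasBoundaryLogModulus G φ) :
    AEStronglyMeasurable fun θ : ℝ => φ (circleMap 0 1 θ) := by
  obtain ⟨r, -, hr, hr1⟩ := exists_seq_strictMono_tendsto' (zero_lt_one' ℝ)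
  have hr1' : Tendsto r atTop (𝓝[<] 1) :=
    tendsto_nhdsWithin_iff.2 ⟨hr1, .of_forall fun n => (hr n).2⟩
  refine aestronglyMeasurable_of_tendsto_ae atTop
    (f := fun n θ => log ‖G (r n * circleMap 0 1 θ)‖) (fun n => ?_) ?_
  · have hcont : Continuous fun θ => G (r n * circleMap 0 1 θ) :=
      hG.comp_continuous (by fun_prop) (ofReal_mul_circleMap_mem_ball (hr n))
    exact (measurable_log.comp hcont.norm.measurable).aestronglyMeasurable
  · filter_upwards [hGφ] with θ hθ
    rw [← log_exp (φ (circleMap 0 1 θ))]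
    exact (hθ.comp hr1').log (exp_ne_zero _)

lemma HasBoundaryLogModulus.circleIntegrable {G : ℂ → ℂ} {φ ψ : ℂ → ℝ}
    (hGψ : HasBoundaryLogModulus G ψ) (hG : IsBoundedAnalytic G) (hφ : CircleIntegrable φ 0 1)
    (hle : ∀ ζ, φ ζ ≤ ψ ζ) : CircleIntegrable ψ 0 1 := by
  obtain ⟨C, hC⟩ := hG.2
  have hupper : ∀ᵐ θ : ℝ, ψ (circleMap 0 1 θ) ≤ C := by
    filter_upwards [hGψ] with θ hθ
    have hexp : exp (ψ (circleMap 0 1 θ)) ≤ C := by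
      refine le_of_tendsto hθ ?_
      filter_upwards [Ioo_mem_nhdsLT one_pos] with r hr
      exact hC _ (ofReal_mul_circleMap_mem_ball hr θ)
    linarith [add_one_le_exp (ψ (circleMap 0 1 θ))]
  refine (IntervalIntegrable.norm hφ).add (circleIntegrable_const |C| 0 1) |>.mono_fun'
    (hGψ.aestronglyMeasurable hG.1.continuousOn).restrict (ae_restrict_of_ae ?_)
  filter_upwards [hupper] with θ hθ
  rw [norm_eq_abs]
  refine (abs_le_max_abs_abs (hle _) hθ).trans (max_le_add_of_nonneg (abs_nonneg _) (abs_nonneg _))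

lemma IsBoundedAnalytic.add_const_mul {g h : ℂ → ℂ} (hg : IsBoundedAnalytic g)
    (hh : IsBoundedAnalytic h) (c : ℂ) : IsBoundedAnalytic fun z => g z + c * h z := by
  obtain ⟨hgan, A, hA⟩ := hg
  obtain ⟨hhan, B, hB⟩ := hh
  refine ⟨hgan.add (analyticOnNhd_const.mul hhan), A + ‖c‖ * B, fun z hz => ?_⟩
  refine norm_add_le_of_le (hA z hz) ((norm_mul_le _ _).trans ?_)
  gcongr
  exact hB z hz

lemma HasBoundaryLogModulus.add_const_mul {g h v : ℂ → ℂ} {φ : ℂ → ℝ}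
    (hh : HasBoundaryLogModulus h φ) (hne : ∀ z ∈ Metric.ball (0 : ℂ) 1, h z ≠ 0)
    (hv : ∀ᵐ θ : ℝ, HasRadialLimit (fun z => g z / h z) (circleMap 0 1 θ) (v (circleMap 0 1 θ)))
    {c : ℂ} (hc : ∀ ζ, v ζ + c ≠ 0) :
    HasBoundaryLogModulus (fun z => g z + c * h z) fun ζ => φ ζ + log ‖v ζ + c‖ := by
  filter_upwards [hh, hv] with θ hhθ hvθ
  rw [exp_add, exp_log (norm_pos_iff.2 (hc _))]
  refine (hhθ.mul (hvθ.add_const c).norm).congr' ?_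
  filter_upwards [Ioo_mem_nhdsLT one_pos] with r hr
  have := hne _ (ofReal_mul_circleMap_mem_ball hr θ)
  rw [← norm_mul]
  congr 1
  field_simp

lemma HasRadialLimit.congr {f g : ℂ → ℂ} (hfg : EqOn f g (Metric.ball 0 1)) {θ : ℝ} {w : ℂ}
    (hf : HasRadialLimit f (circleMap 0 1 θ) w) : HasRadialLimit g (circleMap 0 1 θ) w := by
  refine Tendsto.congr' ?_ hf
  filter_upwards [Ioo_mem_nhdsLT one_pos] with r hr
  exact hfg (ofReal_mul_circleMap_mem_ball hr θ)

lemma IsRealSmirnov.ae_hasRadialLimit_re {f : ℂ → ℂ} (hf : IsRealSmirnov f) :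
    ∀ᵐ θ : ℝ, HasRadialLimit f (circleMap 0 1 θ) ((radialLimit f (circleMap 0 1 θ)).re : ℂ) :=
  hf.2.mono fun _ ⟨x, hx⟩ => by rwa [hx.radialLimit_eq, Complex.ofReal_re]

lemma one_le_norm_ofReal_add_I (x : ℝ) : 1 ≤ ‖(x : ℂ) + Complex.I‖ := by
  simpa using Complex.abs_im_le_norm ((x : ℂ) + Complex.I)

lemma norm_ofReal_add_neg_I (x : ℝ) : ‖(x : ℂ) + -Complex.I‖ = ‖(x : ℂ) + Complex.I‖ := by
  rw [← RCLike.norm_conj]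
  simp only [map_add, map_neg, Complex.conj_ofReal, Complex.conj_I, neg_neg]

lemma exists_isInner_div_outerOf {g h : ℂ → ℂ} (hg : IsBoundedAnalytic g)
    (hh : IsBoundedAnalytic h) (hout : IsOuter h) {x : ℂ → ℝ}
    (hx : ∀ᵐ θ : ℝ, HasRadialLimit (fun z => g z / h z) (circleMap 0 1 θ) (x (circleMap 0 1 θ))) :
    ∃ ψ : ℂ → ℝ, CircleIntegrable ψ 0 1 ∧
      IsInner (fun z => (g z + Complex.I * h z) / outerOf ψ z) ∧
      IsInner (fun z => (g z + -Complex.I * h z) / outerOf ψ z) := by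
  obtain ⟨φ, hφ, hhφ⟩ := hout.exists_hasBoundaryLogModulus
  have hne : ∀ z ∈ Metric.ball (0 : ℂ) 1, h z ≠ 0 := fun z hz => hout.ne_zero hz
  have hpos (ζ : ℂ) : 0 < ‖(x ζ : ℂ) + Complex.I‖ :=
    one_pos.trans_le (one_le_norm_ofReal_add_I (x ζ))
  let ψ : ℂ → ℝ := fun ζ => φ ζ + log ‖(x ζ : ℂ) + Complex.I‖
  have hadd : HasBoundaryLogModulus (fun z => g z + Complex.I * h z) ψ :=
    hhφ.add_const_mul (v := fun ζ => x ζ) hne hx fun ζ => norm_pos_iff.1 (hpos ζ)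
  have hsub : HasBoundaryLogModulus (fun z => g z + -Complex.I * h z) ψ := by
    have hneg := hhφ.add_const_mul (v := fun ζ => x ζ) (c := -Complex.I) hne hx fun ζ =>
      norm_pos_iff.1 (by rw [norm_ofReal_add_neg_I]; exact hpos ζ)
    simpa only [norm_ofReal_add_neg_I] using hneg
  have hψ : CircleIntegrable ψ 0 1 := hadd.circleIntegrable (hg.add_const_mul hh _) hφ fun ζ =>
    le_add_of_nonneg_right (log_nonneg (one_le_norm_ofReal_add_I (x ζ)))
  exact ⟨ψ, hψ, (hg.add_const_mul hh _).isInner_div_outerOf hψ hadd,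
    (hg.add_const_mul hh _).isInner_div_outerOf hψ hsub⟩

end HardyDisc

theorem mainTheorem7 (f : ℂ → ℂ) (hf : HardyDisc.IsRealSmirnov f) :
    ∃ ψ₁ ψ₂ : ℂ → ℂ, HardyDisc.IsInner ψ₁ ∧ HardyDisc.IsInner ψ₂ ∧
      HardyDisc.IsOuter (fun z => ψ₁ z - ψ₂ z) ∧
      ∀ z ∈ Metric.ball (0 : ℂ) 1, f z = Complex.I * ((ψ₁ z + ψ₂ z) / (ψ₁ z - ψ₂ z)) := by
  obtain ⟨g, h, hg, hh, hout, hfgh⟩ := hf.1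
  have hlim := hf.ae_hasRadialLimit_re.mono fun _ hθ => hθ.congr hfgh
  obtain ⟨ψ, hψ, hadd, hsub⟩ := HardyDisc.exists_isInner_div_outerOf hg hh hout
    (x := fun ζ => (HardyDisc.radialLimit f ζ).re) hlim
  have hdiff (z : ℂ) : (g z + Complex.I * h z) / HardyDisc.outerOf ψ z
      - (g z + -Complex.I * h z) / HardyDisc.outerOf ψ z
      = 2 * Complex.I * h z / HardyDisc.outerOf ψ z := by ring
  refine ⟨_, _, hadd, hsub, ?_, fun z hz => ?_⟩
  · simp only [hdiff]
    exact (hout.const_mul (by simp)).div (HardyDisc.isOuter_outerOf hψ)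
  · have hh0 := hout.ne_zero hz
    have hψ0 := HardyDisc.outerOf_ne_zero ψ z
    rw [hdiff, hfgh z hz]
    field_simp
    ring
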